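/- Let $\mathcal H_A=\mathcal H_B=\mathbb C^2$. Let $\mathrm{SES}$ be the cone of positive semidefinite matrices on $\mathcal H_A\otimes\mathcal H_B$, let $\mathrm{SEP}$ be the cone of finite sums $\sum_i a_i\otimes b_i$ with $a_i$ and $b_i$ positive semidefinite matrices on $\mathcal H_A$ and $\mathcal H_B$, and let $\mathrm{SEP}^\ast$ be the set of Hermitian matrices $X$ on $\mathcal H_A\otimes\mathcal H_B$ with $\operatorname{Tr}XY\ge 0$ for all $Y\in\mathrm{SEP}$. For a cone $\mathcal C$ of Hermitian matrices put $\mathcal S(\mathcal C)=\{\rho\in\mathcal C : \operatorname{Tr}\rho=1\}$; a state $\rho\in\mathcal S(\mathcal C)$ is called pure if it is an extreme point of $\mathcal S(\mathcal C)$. A beyond-quantum state is an element of $\mathcal S(\mathrm{SEP}^\ast)\setminus\mathcal S(\mathrm{SES})$. For a Hermitian matrix $\rho$ on $\mathcal H_A\otimes\mathcal H_B$ and unitary $2\times2$ matrices $U_A,U_B$ let $$\mathbb A_{\mathrm{Pauli}}(\rho;U_A,U_B)=\sum_{c=x,y,z}\operatorname{Tr}\,(U_A\otimes U_B)\,\rho\,(U_A^\dagger\otimes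 U_B^\dagger)\,(\sigma_c\otimes\sigma_c),$$ where $\sigma_x=\begin{pmatrix}0&1\\1&0\end{pmatrix}$, $\sigma_y=\begin{pmatrix}0&-i\\i&0\end{pmatrix}$, $\sigma_z=\begin{pmatrix}1&0\\0&-1\end{pmatrix}$. Then: 1. For every beyond-quantum state $\rho_0$ that is a pure state of $\mathcal S(\mathrm{SEP}^\ast)$ there exist unitary matrices $U_A,U_B$ such that $\mathbb A_{\mathrm{Pauli}}(\rho_0;U_A,U_B)>1$. 2. $\mathbb A_{\mathrm{Pauli}}(\rho_1;U_A,U_B)\le 1$ for every $\rho_1\in\mathcal S(\mathrm{SES})$ and all unitary matrices $U_A,U_B$; that is, the supremum of these values is at most $1$. -/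

import Mathlib

open scoped Kronecker Matrix ComplexOrder

/-- The cone `L_H^+` of positive semidefinite complex matrices. -/
def psdCone (n : Type*) [Fintype n] : Set (Matrix n n ℂ) :=
  {X | X.PosSemidef}

/-- The separable cone `SEP(A;B) = L_H^+(H_A) ⊗ L_H^+(H_B)`: all finite sums of Kronecker
products `a ⊗ b` of positive semidefinite matrices. -/
def SEP (m n : Type*) [Fintype m] [Fintype n] : Set (Matrix (m × n) (m × n) ℂ) :=
  {X | ∃ (k : ℕ) (a : Fin k → Matrix m m ℂ) (b : Fin k → Matrix n n ℂ),
    (∀ i, a i ∈ psdCone m) ∧ (∀ i, b i ∈ psdCone n) ∧ X = ∑ i, a i ⊗ₖ b i}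

/-- The dual of a cone `C` in the real space of Hermitian matrices with inner product
`⟨X, Y⟩ = Tr (X Y)` (a real number when `X` and `Y` are Hermitian). -/
def dualCone {n : Type*} [Fintype n] (C : Set (Matrix n n ℂ)) : Set (Matrix n n ℂ) :=
  {X | X.IsHermitian ∧ ∀ Y ∈ C, 0 ≤ (X * Y).trace.re}

/-- The standard entanglement structure `SES(A;B) = L_H^+(H_A ⊗ H_B)`. -/
def SES (m n : Type*) [Fintype m] [Fintype n] : Set (Matrix (m × n) (m × n) ℂ) :=
  psdCone (m × n)

/-- The state space of the model with cone `C` and order unit `I`. -/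
def stateSpace {n : Type*} [Fintype n] (C : Set (Matrix n n ℂ)) : Set (Matrix n n ℂ) :=
  {ρ | ρ ∈ C ∧ ρ.trace = 1}

/-- A beyond-quantum state: a state of `SEP*(A;B)` that is not a state of `SES(A;B)`. -/
def IsBeyondQuantum {m n : Type*} [Fintype m] [Fintype n]
    (ρ : Matrix (m × n) (m × n) ℂ) : Prop :=
  ρ ∈ stateSpace (dualCone (SEP m n)) \ stateSpace (SES m n)

/-- A pure state of the model with cone `C`: an extreme point of its state space. -/
def IsPureState {n : Type*} [Fintype n] (C : Set (Matrix n n ℂ)) (ρ : Matrix n n ℂ) : Prop :=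
  ρ ∈ (stateSpace C).extremePoints ℝ

/-- The Pauli matrices `σ_x, σ_y, σ_z`, indexed by `0, 1, 2`. -/
def pauli : Fin 3 → Matrix (Fin 2) (Fin 2) ℂ :=
  ![!![0, 1; 1, 0], !![0, -Complex.I; Complex.I, 0], !![1, 0; 0, -1]]

/-- `A_Pauli(ρ; U_A, U_B) = ∑_c Tr (U_A ⊗ U_B) ρ (U_A† ⊗ U_B†) (σ_c ⊗ σ_c)`, as a real number.
The trace is real for every Hermitian `ρ`, see `ofReal_APauli`. -/
noncomputable def APauli (ρ : Matrix (Fin 2 × Fin 2) (Fin 2 × Fin 2) ℂ)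
    (UA UB : Matrix (Fin 2) (Fin 2) ℂ) : ℝ :=
  (∑ c, ((UA ⊗ₖ UB) * ρ * (UAᴴ ⊗ₖ UBᴴ) * (pauli c ⊗ₖ pauli c)).trace).re

theorem pauli_isHermitian (c : Fin 3) : (pauli c).IsHermitian := by
  ext i j
  fin_cases c <;> fin_cases i <;> fin_cases j <;> simp [pauli]

/-- For Hermitian `ρ` the complex trace expression is the real number `APauli ρ UA UB`. -/
theorem ofReal_APauli {ρ : Matrix (Fin 2 × Fin 2) (Fin 2 × Fin 2) ℂ} (hρ : ρ.IsHermitian)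
    (UA UB : Matrix (Fin 2) (Fin 2) ℂ) :
    (APauli ρ UA UB : ℂ) =
      ∑ c, ((UA ⊗ₖ UB) * ρ * (UAᴴ ⊗ₖ UBᴴ) * (pauli c ⊗ₖ pauli c)).trace := by
  unfold APauli
  refine Complex.conj_eq_iff_re.mp ?_
  rw [map_sum]
  refine Finset.sum_congr rfl fun c _ => ?_
  rw [starRingEnd_apply, ← Matrix.trace_conjTranspose, Matrix.conjTranspose_mul,
    Matrix.conjTranspose_mul, Matrix.conjTranspose_mul, hρ.eq, Matrix.conjTranspose_kronecker,
    Matrix.conjTranspose_kronecker, Matrix.conjTranspose_kronecker, (pauli_isHermitian c).eq,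
    Matrix.conjTranspose_conjTranspose, Matrix.conjTranspose_conjTranspose, Matrix.trace_mul_comm]
  simp only [Matrix.mul_assoc]

/-! The Pauli sum is 2S - 1, where S is the swap, so both claims compare Tr(ρS) with 1 after a local
rotation (`sum_trace_mul_pauli`). Quantum states satisfy Tr(ρS) ≤ 1 because 1 - S is positive
semidefinite, being a multiple of the singlet projection.

For a beyond-quantum pure state, the key is that on two qubits every block positive matrix has the
form P + Γ(Q), with P, Q positive semidefinite and Γ the partial transpose
(`IsBlockPositive.isDecomposable`, the Størmer–Woronowicz theorem). Both summands lie in SEP*.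
Extremality then leaves a single term: a nonzero P would make the state quantum, so ρ = c Γ(ψψ*)
(`IsPureState.exists_eq_partialTranspose`).

Let M be the coefficient matrix of ψ. Since S is the partial transpose of the unnormalized maximally
entangled projection, rotating the first factor by U gives Tr(ρS) = c |tr(UM)|². The best U yields
the squared trace norm ‖M‖₂² + 2|det M| (`exists_unitary_norm_trace_sq`), while Tr ρ = 1 says c‖M‖₂²
= 1. The Pauli value is thus 1 + 4c|det M|. It exceeds 1, because det M = 0 would make ψ a product
vector and ρ quantum. -/

/-! ### Partial transposition. -/

/-- The partial transpose on the second tensor factor. -/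
def partialTranspose {m n R : Type*} (X : Matrix (m × n) (m × n) R) : Matrix (m × n) (m × n) R :=
  Matrix.of fun p q => X (p.1, q.2) (q.1, p.2)

section PartialTranspose

variable {m n : Type*}

@[simp]
theorem partialTranspose_apply {R : Type*} (X : Matrix (m × n) (m × n) R) (p q : m × n) :
    partialTranspose X p q = X (p.1, q.2) (q.1, p.2) := rfl

theorem partialTranspose_isHermitian {X : Matrix (m × n) (m × n) ℂ} (hX : X.IsHermitian) :
    (partialTranspose X).IsHermitian := by
  ext p q
  exact hX.apply _ _

variable [Fintype m] [Fintype n]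

theorem trace_partialTranspose (X : Matrix (m × n) (m × n) ℂ) :
    (partialTranspose X).trace = X.trace := rfl

theorem trace_partialTranspose_mul_kronecker (X : Matrix (m × n) (m × n) ℂ) (a : Matrix m m ℂ)
    (b : Matrix n n ℂ) :
    (partialTranspose X * (a ⊗ₖ b)).trace = (X * (a ⊗ₖ bᵀ)).trace := by
  simp only [Matrix.trace, Matrix.diag, Matrix.mul_apply, Fintype.sum_prod_type,
    partialTranspose_apply, Matrix.kroneckerMap_apply, Matrix.transpose_apply]
  refine Finset.sum_congr rfl fun i _ => ?_
  conv_lhs => rw [Finset.sum_comm]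
  conv_rhs => rw [Finset.sum_comm]
  exact Finset.sum_congr rfl fun k _ => Finset.sum_comm

/-- Partial transposition turns conjugation by `A ⊗ B` into conjugation by `A ⊗ B̄`. -/
theorem partialTranspose_conj (A : Matrix m m ℂ) (B : Matrix n n ℂ)
    (X : Matrix (m × n) (m × n) ℂ) :
    partialTranspose ((A ⊗ₖ B) * X * (A ⊗ₖ B)ᴴ) =
      (A ⊗ₖ B.map star) * partialTranspose X * (A ⊗ₖ B.map star)ᴴ := by
  ext ⟨i, j⟩ ⟨k, l⟩
  simp only [Matrix.mul_apply, Fintype.sum_prod_type, Finset.sum_mul,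
    partialTranspose_apply, Matrix.kroneckerMap_apply, Matrix.conjTranspose_apply,
    Matrix.map_apply, star_mul', star_star]
  refine Finset.sum_congr rfl fun a _ => ?_
  conv_lhs => rw [Finset.sum_comm]
  conv_rhs => rw [Finset.sum_comm]
  refine Finset.sum_congr rfl fun d _ => ?_
  rw [Finset.sum_comm]
  refine Finset.sum_congr rfl fun e _ => Finset.sum_congr rfl fun f _ => ?_
  ring

end PartialTranspose

/-! ### The cone SEP* and its extreme states. -/

open scoped MatrixOrder Matrix.Norms.L2Operator in
theorem Matrix.PosSemidef.exists_eq_conjTranspose_mul_self {n : Type*} [Fintype n]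
    {A : Matrix n n ℂ} (hA : A.PosSemidef) : ∃ B : Matrix n n ℂ, A = Bᴴ * B := by
  classical
  exact CStarAlgebra.nonneg_iff_eq_star_mul_self.mp hA.nonneg

theorem trace_mul_nonneg_of_posSemidef {n : Type*} [Fintype n] {A B : Matrix n n ℂ}
    (hA : A.PosSemidef) (hB : B.PosSemidef) : 0 ≤ (A * B).trace.re := by
  obtain ⟨C, rfl⟩ := hB.exists_eq_conjTranspose_mul_self
  rw [← Matrix.mul_assoc, Matrix.trace_mul_comm, ← Matrix.mul_assoc]
  exact (Complex.nonneg_iff.mp (hA.mul_mul_conjTranspose_same C).trace_nonneg).1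

section DualCone

variable {m n : Type*} [Fintype m] [Fintype n]

theorem add_mem_dualCone {C : Set (Matrix n n ℂ)} {X Y : Matrix n n ℂ} (hX : X ∈ dualCone C)
    (hY : Y ∈ dualCone C) : X + Y ∈ dualCone C := by
  refine ⟨hX.1.add hY.1, fun Z hZ => ?_⟩
  rw [add_mul, Matrix.trace_add, Complex.add_re]
  exact add_nonneg (hX.2 Z hZ) (hY.2 Z hZ)

theorem smul_mem_dualCone {C : Set (Matrix n n ℂ)} {X : Matrix n n ℂ} (hX : X ∈ dualCone C)
    {t : ℝ} (ht : 0 ≤ t) : t • X ∈ dualCone C := by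
  refine ⟨?_, fun Z hZ => ?_⟩
  · rw [Matrix.IsHermitian, Matrix.conjTranspose_smul, hX.1.eq, star_trivial]
  · rw [smul_mul_assoc, Matrix.trace_smul, Complex.smul_re]
    exact mul_nonneg ht (hX.2 Z hZ)

theorem mem_dualCone_SEP_iff {X : Matrix (m × n) (m × n) ℂ} :
    X ∈ dualCone (SEP m n) ↔ X.IsHermitian ∧
      ∀ a b, a.PosSemidef → b.PosSemidef → 0 ≤ (X * (a ⊗ₖ b)).trace.re := by
  refine ⟨fun h => ⟨h.1, fun a b ha hb => h.2 _ ?_⟩, fun h => ⟨h.1, ?_⟩⟩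
  · exact ⟨1, fun _ => a, fun _ => b, fun _ => ha, fun _ => hb, by simp⟩
  · rintro _ ⟨k, a, b, ha, hb, rfl⟩
    rw [Finset.mul_sum, Matrix.trace_sum, Complex.re_sum]
    exact Finset.sum_nonneg fun i _ => h.2 _ _ (ha i) (hb i)

theorem Matrix.PosSemidef.mem_dualCone_SEP {X : Matrix (m × n) (m × n) ℂ}
    (hX : X.PosSemidef) : X ∈ dualCone (SEP m n) := by
  classical
  exact mem_dualCone_SEP_iff.mpr
    ⟨hX.1, fun _ _ ha hb => trace_mul_nonneg_of_posSemidef hX (ha.kronecker hb)⟩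

theorem Matrix.PosSemidef.partialTranspose_mem_dualCone_SEP {X : Matrix (m × n) (m × n) ℂ}
    (hX : X.PosSemidef) : partialTranspose X ∈ dualCone (SEP m n) := by
  classical
  refine mem_dualCone_SEP_iff.mpr ⟨partialTranspose_isHermitian hX.1, fun a b ha hb => ?_⟩
  rw [trace_partialTranspose_mul_kronecker]
  exact trace_mul_nonneg_of_posSemidef hX (ha.kronecker hb.transpose)

theorem trace_re_nonneg_of_mem_dualCone_SEP {X : Matrix (m × n) (m × n) ℂ}
    (hX : X ∈ dualCone (SEP m n)) : 0 ≤ X.trace.re := by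
  classical
  simpa using (mem_dualCone_SEP_iff.mp hX).2 1 1 .one .one

theorem ofReal_trace_re {X : Matrix n n ℂ} (hX : X.IsHermitian) : (X.trace.re : ℂ) = X.trace := by
  refine Complex.conj_eq_iff_re.mp ?_
  rw [starRingEnd_apply, ← Matrix.trace_conjTranspose, hX.eq]

/-- A summand of nonzero trace of a pure state is proportional to that state. -/
theorem IsPureState.eq_smul_of_eq_add {ρ X Y : Matrix (m × n) (m × n) ℂ}
    (hρ : IsPureState (dualCone (SEP m n)) ρ) (hX : X ∈ dualCone (SEP m n))
    (hY : Y ∈ dualCone (SEP m n)) (h : ρ = X + Y) (ht : 0 < X.trace.re) :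
    ρ = X.trace.re⁻¹ • X := by
  have htr : X.trace.re + Y.trace.re = 1 := by
    rw [← Complex.add_re, ← Matrix.trace_add, ← h, hρ.1.2, Complex.one_re]
  have hY0 := trace_re_nonneg_of_mem_dualCone_SEP hY
  set t := X.trace.re with ht_def
  -- Only half of X is split off: the remainder X/2 + Y has trace 1 - t/2 > 0 even when Y has trace
  -- zero, so both parts can be normalized.
  have hZ : (1 / 2 : ℝ) • X + Y ∈ dualCone (SEP m n) :=
    add_mem_dualCone (smul_mem_dualCone hX (by norm_num)) hY
  have hs : 0 < 1 - t / 2 := by linarith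
  refine (hρ.2 (x₁ := t⁻¹ • X) ?_ (x₂ := (1 - t / 2)⁻¹ • ((1 / 2 : ℝ) • X + Y)) ?_ ?_).symm
  · refine ⟨smul_mem_dualCone hX (by positivity), ?_⟩
    rw [Matrix.trace_smul, ← ofReal_trace_re hX.1, ← ht_def, Complex.real_smul,
      ← Complex.ofReal_mul, inv_mul_cancel₀ ht.ne', Complex.ofReal_one]
  · refine ⟨smul_mem_dualCone hZ (by positivity), ?_⟩
    rw [Matrix.trace_smul, ← ofReal_trace_re hZ.1, Complex.real_smul, Matrix.trace_add,
      Matrix.trace_smul, Complex.add_re, Complex.smul_re, ← ht_def, ← Complex.ofReal_mul,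
      smul_eq_mul, show 1 / 2 * t + Y.trace.re = 1 - t / 2 by linarith, inv_mul_cancel₀ hs.ne',
      Complex.ofReal_one]
  · refine ⟨t / 2, 1 - t / 2, by positivity, hs, by ring, ?_⟩
    rw [smul_smul, smul_smul, mul_inv_cancel₀ hs.ne', one_smul, ← add_assoc, ← add_smul, h]
    congr 1
    rw [show t / 2 * t⁻¹ + 1 / 2 = 1 by field_simp; norm_num, one_smul]

end DualCone

/-! ### Nonnegative quadratic polynomials in real and complex variables. -/

theorem leadingCoeff_nonneg_of_quadratic_nonneg {a b c : ℝ}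
    (h : ∀ t : ℝ, 0 ≤ a * (t * t) + b * t + c) : 0 ≤ a := by
  have hc : 0 ≤ c := by simpa using h 0
  have hd := discrim_le_zero h
  rw [discrim] at hd
  by_contra! ha
  have h1 := h 1
  have h2 := h (-1)
  rcases hc.eq_or_lt with rfl | hc'
  · linarith
  · nlinarith [sq_nonneg b, mul_pos hc' (neg_pos.mpr ha)]

/-- A nonnegative quadratic polynomial in two real variables has a critical point. -/
theorem exists_critical_point_of_quadratic_nonneg {a b d l m c : ℝ}
    (h : ∀ x y : ℝ, 0 ≤ a * x ^ 2 + 2 * b * (x * y) + d * y ^ 2 + 2 * l * x + 2 * m * y + c) :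
    ∃ x y : ℝ, a * x + b * y + l = 0 ∧ b * x + d * y + m = 0 := by
  -- Restriction to the line spanned by (u, v): the discriminant bounds the linear part by the
  -- quadratic part.
  have key : ∀ u v : ℝ, 0 ≤ a * u ^ 2 + 2 * b * (u * v) + d * v ^ 2 ∧
      (l * u + m * v) ^ 2 ≤ (a * u ^ 2 + 2 * b * (u * v) + d * v ^ 2) * c := by
    intro u v
    have hq : ∀ t : ℝ, 0 ≤ (a * u ^ 2 + 2 * b * (u * v) + d * v ^ 2) * (t * t) +
        (2 * (l * u + m * v)) * t + c := fun t => by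
      have := h (t * u) (t * v)
      linarith
    refine ⟨leadingCoeff_nonneg_of_quadratic_nonneg hq, ?_⟩
    have := discrim_le_zero hq
    rw [discrim] at this
    linarith
  have ha : 0 ≤ a := by simpa using (key 1 0).1
  have hd : 0 ≤ d := by simpa using (key 0 1).1
  by_cases hD : a * d - b ^ 2 = 0
  · rcases ha.eq_or_lt with rfl | ha
    · have hb : b = 0 := by simpa using hD
      have hl : l = 0 := by
        simpa using le_antisymm (by simpa using (key 1 0).2) (sq_nonneg l)
      subst hb hl
      rcases hd.eq_or_lt with rfl | hd
      · have hm : m = 0 := by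
          simpa using le_antisymm (by simpa using (key 0 1).2) (sq_nonneg m)
        exact ⟨0, 0, by simp [hm]⟩
      · exact ⟨0, -m / d, by simp, by field_simp; ring⟩
    -- The vector (-b, a) spans the kernel of the singular quadratic part, so the linear part
    -- vanishes on it and the critical equations are consistent.
    · have hk := (key (-b) a).2
      have hz : a * (-b) ^ 2 + 2 * b * (-b * a) + d * a ^ 2 = 0 := by
        linear_combination a * hD
      rw [hz, zero_mul] at hk
      have hlm : l * -b + m * a = 0 := by
        simpa using le_antisymm hk (sq_nonneg _)
      refine ⟨-l / a, 0, by field_simp; ring, ?_⟩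
      field_simp
      linarith
  · obtain ⟨D, hD'⟩ : ∃ D, D = a * d - b ^ 2 := ⟨_, rfl⟩
    rw [← hD'] at hD
    refine ⟨(b * m - d * l) / D, (b * l - a * m) / D, ?_, ?_⟩
    · field_simp
      linear_combination l * hD'
    · field_simp
      linear_combination m * hD'

/-- If `q (p |z|² + 2 Re (z̄ h) + r) - |ē z + c z̄ + g|²` is nonnegative for all `z`, then its
derivative with respect to `z̄` vanishes somewhere. -/
theorem exists_critical_point_complex {p q r : ℝ} {c e g h : ℂ}
    (H : ∀ z : ℂ, ‖star e * z + c * star z + g‖ ^ 2 ≤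
      q * (p * ‖z‖ ^ 2 + 2 * (star z * h).re + r)) :
    ∃ z : ℂ, (q : ℂ) * (h + p * z) =
      e * (star e * z + c * star z + g) + c * star (star e * z + c * star z + g) := by
  obtain ⟨e1, e2⟩ := e
  obtain ⟨c1, c2⟩ := c
  obtain ⟨g1, g2⟩ := g
  obtain ⟨h1, h2⟩ := h
  obtain ⟨x, y, hx, hy⟩ := exists_critical_point_of_quadratic_nonneg
    (a := q * p - (e1 + c1) ^ 2 - (c2 - e2) ^ 2)
    (b := -((e1 + c1) * (e2 + c2) + (c2 - e2) * (e1 - c1)))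
    (d := q * p - (e2 + c2) ^ 2 - (e1 - c1) ^ 2)
    (l := q * h1 - (e1 + c1) * g1 - (c2 - e2) * g2)
    (m := q * h2 - (e2 + c2) * g1 - (e1 - c1) * g2)
    (c := q * r - g1 ^ 2 - g2 ^ 2) (fun x y => by
      have := H ⟨x, y⟩
      simp only [← Complex.normSq_eq_norm_sq, Complex.normSq_apply, Complex.star_def,
        Complex.add_re, Complex.add_im, Complex.mul_re, Complex.mul_im, Complex.conj_re,
        Complex.conj_im] at this
      linarith)
  refine ⟨⟨x, y⟩, Complex.ext ?_ ?_⟩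
  · simp only [Complex.star_def, Complex.add_re, Complex.add_im, Complex.mul_re, Complex.mul_im,
      Complex.conj_re, Complex.conj_im, Complex.ofReal_re, Complex.ofReal_im]
    linear_combination hx
  · simp only [Complex.star_def, Complex.add_re, Complex.add_im, Complex.mul_re, Complex.mul_im,
      Complex.conj_re, Complex.conj_im, Complex.ofReal_re, Complex.ofReal_im]
    linear_combination hy

theorem exists_phase (z : ℂ) : ∃ u : ℂ, ‖u‖ = 1 ∧ z = ‖z‖ * u :=
  ⟨Complex.exp (z.arg * Complex.I), Complex.norm_exp_ofReal_mul_I _,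
    (Complex.norm_mul_exp_arg_mul_I z).symm⟩

theorem mul_star_of_norm_eq_one {u : ℂ} (hu : ‖u‖ = 1) : u * star u = 1 := by
  rw [Complex.star_def, Complex.mul_conj, Complex.normSq_eq_norm_sq, hu]
  simp

/-- The quadratic coefficient of a nonnegative polynomial
`q (p |z|² + 2 Re (z̄ h) + r) - |ē z + c z̄ + g|²`, evaluated in the worst direction. -/
theorem sq_norm_add_norm_le {p q r : ℝ} {c e g h : ℂ}
    (H : ∀ z : ℂ, ‖star e * z + c * star z + g‖ ^ 2 ≤
      q * (p * ‖z‖ ^ 2 + 2 * (star z * h).re + r)) :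
    (‖c‖ + ‖e‖) ^ 2 ≤ q * p := by
  obtain ⟨u, hu, hcu⟩ := exists_phase c
  obtain ⟨v, hv, hev⟩ := exists_phase e
  -- With w² = uv the terms ē w and c w̄ have the same phase, so their moduli add.
  obtain ⟨w, hw⟩ := IsAlgClosed.exists_pow_nat_eq (u * v) two_pos
  have hwn : ‖w‖ = 1 := by
    have : ‖w‖ ^ 2 = 1 := by rw [← norm_pow, hw, norm_mul, hu, hv, one_mul]
    exact (pow_eq_one_iff_of_nonneg (norm_nonneg w) two_ne_zero).mp this
  have hww := mul_star_of_norm_eq_one hwn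
  have hvv := mul_star_of_norm_eq_one hv
  set x := star e * w + c * star w with hx
  have hxw : x * w = ((‖c‖ + ‖e‖ : ℝ) : ℂ) * u := by
    have hse : star e = ‖e‖ * star v := by
      conv_lhs => rw [hev]
      rw [star_mul', Complex.star_def, Complex.conj_ofReal]
    rw [hx, hse]
    nth_rewrite 1 [hcu]
    push_cast
    linear_combination (‖e‖ : ℂ) * star v * hw + (‖c‖ : ℂ) * u * hww + (‖e‖ : ℂ) * u * hvv
  have hxn : ‖x‖ = ‖c‖ + ‖e‖ := by
    have := congrArg norm hxw
    rwa [norm_mul, norm_mul, hwn, hu, mul_one, mul_one, Complex.norm_real,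
      Real.norm_of_nonneg (by positivity)] at this
  have hq : ∀ t : ℝ, 0 ≤ (q * p - ‖x‖ ^ 2) * (t * t) +
      (2 * q * (star w * h).re - 2 * (x * star g).re) * t + (q * r - ‖g‖ ^ 2) := fun t => by
    have ht := H (t * w)
    have h1 : star e * (t * w) + c * star (t * w) + g = t * x + g := by
      rw [hx, star_mul', Complex.star_def, Complex.conj_ofReal]
      ring
    have h2 : ‖(t : ℂ) * x + g‖ ^ 2 = ‖x‖ ^ 2 * (t * t) + 2 * (x * star g).re * t + ‖g‖ ^ 2 := by
      simp only [← Complex.normSq_eq_norm_sq, Complex.normSq_apply, Complex.star_def,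
        Complex.add_re, Complex.add_im, Complex.mul_re, Complex.mul_im, Complex.conj_re,
        Complex.conj_im, Complex.ofReal_re, Complex.ofReal_im]
      ring
    have h3 : (star ((t : ℂ) * w) * h).re = t * (star w * h).re := by
      rw [star_mul', Complex.star_def, Complex.conj_ofReal, mul_assoc, Complex.re_ofReal_mul]
    rw [h1, h2, h3, norm_mul, hwn, mul_one, Complex.norm_real, Real.norm_eq_abs, sq_abs] at ht
    linarith
  have := leadingCoeff_nonneg_of_quadratic_nonneg hq
  rw [hxn] at this
  linarith

/-- Two complex numbers are convex weights times numbers of equal modulus. -/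
theorem exists_convex_weights (c e : ℂ) :
    ∃ (s t : ℝ) (c' e' : ℂ), 0 ≤ s ∧ 0 ≤ t ∧ s + t = 1 ∧ c = s * c' ∧ e = t * e' ∧
      ‖c'‖ = ‖c‖ + ‖e‖ ∧ ‖e'‖ = ‖c‖ + ‖e‖ := by
  obtain ⟨u, hu, hcu⟩ := exists_phase c
  obtain ⟨v, hv, hev⟩ := exists_phase e
  have hk : 0 ≤ ‖c‖ + ‖e‖ := by positivity
  have hn : ∀ w : ℂ, ‖w‖ = 1 → ‖((‖c‖ + ‖e‖ : ℝ) : ℂ) * w‖ = ‖c‖ + ‖e‖ := fun w hw => by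
    rw [norm_mul, hw, mul_one, Complex.norm_real, Real.norm_of_nonneg hk]
  rcases hk.eq_or_lt with h0 | h0
  · have hc : c = 0 := norm_eq_zero.mp (by linarith [norm_nonneg c, norm_nonneg e])
    have he : e = 0 := norm_eq_zero.mp (by linarith [norm_nonneg c, norm_nonneg e])
    exact ⟨1, 0, 0, 0, by simp [hc, he]⟩
  · refine ⟨‖c‖ / (‖c‖ + ‖e‖), ‖e‖ / (‖c‖ + ‖e‖), (‖c‖ + ‖e‖ : ℝ) * u, (‖c‖ + ‖e‖ : ℝ) * v,
      by positivity, by positivity, by field_simp, ?_, ?_, hn u hu, hn v hv⟩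
    · rw [← mul_assoc, ← Complex.ofReal_mul, div_mul_cancel₀ _ h0.ne', ← hcu]
    · rw [← mul_assoc, ← Complex.ofReal_mul, div_mul_cancel₀ _ h0.ne', ← hev]

/-! ### Decomposability of block positive matrices with a vanishing corner. -/

/-- The product vector `a ⊗ b`. -/
def prodVec {m n : Type*} (a : m → ℂ) (b : n → ℂ) : m × n → ℂ := fun p => a p.1 * b p.2

/-- A Hermitian matrix is block positive if its quadratic form is nonnegative on product
vectors. -/
def IsBlockPositive {m n : Type*} [Fintype m] [Fintype n] (W : Matrix (m × n) (m × n) ℂ) : Prop :=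
  W.IsHermitian ∧ ∀ a b, 0 ≤ (star (prodVec a b) ⬝ᵥ W *ᵥ prodVec a b).re

/-- A matrix is decomposable if it is the sum of a positive semidefinite matrix and the partial
transpose of a positive semidefinite matrix. -/
def IsDecomposable {m n : Type*} [Fintype m] [Fintype n] (W : Matrix (m × n) (m × n) ℂ) : Prop :=
  ∃ P Q : Matrix (m × n) (m × n) ℂ, P.PosSemidef ∧ Q.PosSemidef ∧ W = P + partialTranspose Q

theorem eq_zero_of_forall_re_nonneg {x : ℂ} {y : ℝ}
    (h : ∀ t : ℂ, 0 ≤ 2 * (t * x).re + ‖t‖ ^ 2 * y) : x = 0 := by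
  have hq : ∀ s : ℝ, 0 ≤ (‖x‖ ^ 2 * y) * (s * s) + (2 * ‖x‖ ^ 2) * s + 0 := fun s => by
    have hs := h (s * star x)
    have h1 : ((s : ℂ) * star x * x).re = s * ‖x‖ ^ 2 := by
      rw [mul_assoc, Complex.re_ofReal_mul, mul_comm (star x), Complex.star_def, Complex.mul_conj,
        Complex.ofReal_re, Complex.normSq_eq_norm_sq]
    rw [h1, norm_mul, norm_star, Complex.norm_real, mul_pow, Real.norm_eq_abs, sq_abs] at hs
    linarith
  have := discrim_le_zero hq
  rw [discrim] at this
  have h4 : ‖x‖ ^ 4 ≤ 0 := by linarith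
  exact norm_eq_zero.mp (pow_eq_zero_iff four_ne_zero |>.mp (le_antisymm h4 (by positivity)))

theorem norm_sq_le_of_hermitian_form_nonneg {q N : ℝ} {G : ℂ} (hq : 0 < q)
    (h : ∀ x y : ℂ, 0 ≤ q * ‖x‖ ^ 2 + 2 * (star x * y * G).re + N * ‖y‖ ^ 2) :
    ‖G‖ ^ 2 ≤ q * N := by
  -- For fixed y the form is smallest at x = -yG/q; the choice y = q clears the denominator.
  have h1 := h (-G) q
  have h2 : (star (-G) * q * G).re = - (q * ‖G‖ ^ 2) := by
    rw [← Complex.normSq_eq_norm_sq, Complex.normSq_apply]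
    simp [Complex.mul_re, Complex.mul_im]
    ring
  rw [h2, norm_neg, Complex.norm_real, Real.norm_eq_abs, sq_abs] at h1
  have h3 : 0 ≤ q * (q * N - ‖G‖ ^ 2) := by linarith
  linarith [(mul_nonneg_iff_of_pos_left hq).mp h3]

/-- A matrix on `ℂ² ⊗ ℂ²` whose entries in the row and column `(0, 0)` vanish outside the
antidiagonal. -/
def cornerMatrix (p q r : ℝ) (c e g h : ℂ) : Matrix (Fin 2 × Fin 2) (Fin 2 × Fin 2) ℂ :=
  Matrix.of fun i j =>
    (!![0, 0, 0, c; 0, p, e, h; 0, star e, q, g; star c, star h, star g, r] :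
      Matrix (Fin 4) (Fin 4) ℂ) (finProdFinEquiv i) (finProdFinEquiv j)

theorem cornerMatrix_form (p q r : ℝ) (c e g h : ℂ) (z x y : ℂ) :
    (star (prodVec ![z, 1] ![x, y]) ⬝ᵥ
      cornerMatrix p q r c e g h *ᵥ prodVec ![z, 1] ![x, y]).re =
      q * ‖x‖ ^ 2 + 2 * (star x * y * (star e * z + c * star z + g)).re +
        (p * ‖z‖ ^ 2 + 2 * (star z * h).re + r) * ‖y‖ ^ 2 := by
  simp [dotProduct, Matrix.mulVec, Fintype.sum_prod_type, Fin.sum_univ_two, prodVec, cornerMatrix,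
    finProdFinEquiv, ← Complex.normSq_eq_norm_sq, Complex.normSq_apply, Complex.mul_re,
    Complex.mul_im]
  ring

/-- Fixing the first factor (z, 1) leaves a Hermitian form in the second, whose determinant
condition is |G(z)|² ≤ q N(z), with G(z) = ē z + c z̄ + g and N(z) = p|z|² + 2 Re(z̄ h) + r. The gap
q N - |G|² is a nonnegative quadratic polynomial in z. A critical point of it, together with the
bound (|c| + |e|)² ≤ qp on its leading part, yields an explicit decomposition. -/
theorem IsBlockPositive.cornerMatrix_isDecomposable {p q r : ℝ} {c e g h : ℂ} (hq : 0 < q)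
    (H : IsBlockPositive (cornerMatrix p q r c e g h)) :
    IsDecomposable (cornerMatrix p q r c e g h) := by
  have H' : ∀ z : ℂ, ‖star e * z + c * star z + g‖ ^ 2 ≤
      q * (p * ‖z‖ ^ 2 + 2 * (star z * h).re + r) := fun z =>
    norm_sq_le_of_hermitian_form_nonneg hq fun x y => by
      rw [← cornerMatrix_form]
      exact H.2 _ _
  obtain ⟨z, hz⟩ := exists_critical_point_complex H'
  have hp := sq_norm_add_norm_le H'
  have hr := H' z
  -- Since c' and e' share the modulus k and s + t = 1, the two rank one terms below together
  -- contribute exactly k²/q and q to the middle diagonal entries.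
  obtain ⟨s, t, c', e', hs, ht, hst, hc, he, hc', he'⟩ := exists_convex_weights c e
  set G := star e * z + c * star z + g with hG
  set k := ‖c‖ + ‖e‖ with hk
  have hqc : (q : ℂ) ≠ 0 := by exact_mod_cast hq.ne'
  have hee : e' * star e' = (k : ℂ) ^ 2 := by
    rw [Complex.star_def, Complex.mul_conj, Complex.normSq_eq_norm_sq, he']; push_cast; rfl
  have hcc : c' * star c' = (k : ℂ) ^ 2 := by
    rw [Complex.star_def, Complex.mul_conj, Complex.normSq_eq_norm_sq, hc']; push_cast; rfl
  have hstc : (s : ℂ) + t = 1 := by exact_mod_cast hst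
  clear_value G k
  subst hc he
  let C : ℝ := p * ‖z‖ ^ 2 + 2 * (star z * h).re + r - ‖G‖ ^ 2 / q
  have hC : 0 ≤ C := by
    have : ‖G‖ ^ 2 / q ≤ p * ‖z‖ ^ 2 + 2 * (star z * h).re + r := by
      rw [div_le_iff₀ hq]; linarith
    exact sub_nonneg.mpr this
  have hCc : (C : ℂ) = p * (z * star z) + (star z * h + z * star h) + r - G * star G / q := by
    have h1 : ((2 * (star z * h).re : ℝ) : ℂ) = star z * h + z * star h := by
      rw [← Complex.add_conj]
      simp
    simp only [Complex.star_def, Complex.mul_conj'] at h1 ⊢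
    rw [← h1]
    simp [C]
  have hp' : 0 ≤ p - k ^ 2 / q := by
    rw [sub_nonneg, div_le_iff₀ hq]; linarith
  -- The vector v produces the entry e, and w produces c once partial transposition moves it to the
  -- corner. The vector u is orthogonal to every (z, 1) ⊗ b and supplies the rest of p; the critical
  -- equation is what makes the entry h agree. The last diagonal entry is completed by o, with
  -- weight C the gap at z divided by q.
  let v : Fin 2 × Fin 2 → ℂ := fun i => ![![0, e'], ![q, star (G - star e' * z)]] i.1 i.2
  let w : Fin 2 × Fin 2 → ℂ := fun i => ![![0, c'], ![q, G - c' * star z]] i.1 i.2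
  let u : Fin 2 × Fin 2 → ℂ := fun i => ![![0, 1], ![0, -star z]] i.1 i.2
  let o : Fin 2 × Fin 2 → ℂ := fun i => ![![0, 0], ![0, 1]] i.1 i.2
  have hz' := congrArg star hz
  have hG' := congrArg star hG
  refine ⟨(t / q) • Matrix.vecMulVec v (star v) + (p - k ^ 2 / q) • Matrix.vecMulVec u (star u) +
    C • Matrix.vecMulVec o (star o), (s / q) • Matrix.vecMulVec w (star w), ?_, ?_, ?_⟩
  · exact (((Matrix.posSemidef_vecMulVec_self_star v).smul (by positivity)).add
      ((Matrix.posSemidef_vecMulVec_self_star u).smul hp')).add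
      ((Matrix.posSemidef_vecMulVec_self_star o).smul hC)
  · exact (Matrix.posSemidef_vecMulVec_self_star w).smul (by positivity)
  · ext ⟨i, j⟩ ⟨i', j'⟩
    simp only [Matrix.add_apply, Matrix.smul_apply, partialTranspose_apply, Matrix.vecMulVec_apply,
      Complex.real_smul, Pi.star_apply, hCc]
    fin_cases i <;> fin_cases j <;> fin_cases i' <;> fin_cases j' <;>
      simp [cornerMatrix, finProdFinEquiv, v, w, u, o] at hz' hG' hz hG hee hcc ⊢ <;>
      field_simp
    · linear_combination -t * hee - s * hcc - k ^ 2 * hstc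
    · linear_combination hz + t * z * hee + s * z * hcc + z * k ^ 2 * hstc
    · linear_combination -hstc
    · linear_combination -hG - G * hstc
    · linear_combination hz' + t * starRingEnd ℂ z * hee + s * starRingEnd ℂ z * hcc +
        starRingEnd ℂ z * k ^ 2 * hstc
    · linear_combination -hG' - starRingEnd ℂ G * hstc
    · linear_combination -starRingEnd ℂ z * hz - z * hz' - z * starRingEnd ℂ z * t * hee -
        z * starRingEnd ℂ z * s * hcc - (z * starRingEnd ℂ z * k ^ 2 + G * starRingEnd ℂ G) * hstc

/-- With q = 0 the off-diagonal function G vanishes identically, hence c = e = g = 0. What remains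
is supported on ℂ² ⊗ e₁, where every vector is a product, so block positivity is positivity. -/
theorem IsBlockPositive.cornerMatrix_zero_isDecomposable {p r : ℝ} {c e g h : ℂ}
    (H : IsBlockPositive (cornerMatrix p 0 r c e g h)) :
    IsDecomposable (cornerMatrix p 0 r c e g h) := by
  have hG : ∀ z : ℂ, star e * z + c * star z + g = 0 := fun z =>
    eq_zero_of_forall_re_nonneg (y := p * ‖z‖ ^ 2 + 2 * (star z * h).re + r) fun t => by
      have := H.2 ![z, 1] ![1, t]
      rw [cornerMatrix_form] at this
      simpa [mul_comm] using this
  have hg : g = 0 := by simpa using hG 0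
  have h1 : star e + c = 0 := by simpa [hg] using hG 1
  have h2 : star e - c = 0 := by
    have := hG Complex.I
    rw [hg, show star Complex.I = -Complex.I from Complex.conj_I] at this
    have h3 : (star e - c) * Complex.I = 0 := by linear_combination this
    simpa using h3
  have hc : c = 0 := by linear_combination h1 / 2 - h2 / 2
  have he : e = 0 := star_eq_zero.mp (by linear_combination h1 / 2 + h2 / 2)
  refine ⟨cornerMatrix p 0 r c e g h, 0, ?_, .zero, by ext; simp⟩
  refine .of_dotProduct_mulVec_nonneg H.1 fun x => Complex.nonneg_iff.mpr ⟨?_, ?_⟩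
  · have := H.2 ![x (0, 1), x (1, 1)] ![0, 1]
    refine this.trans_eq (congrArg Complex.re ?_)
    simp [dotProduct, Matrix.mulVec, Fintype.sum_prod_type, Fin.sum_univ_two, prodVec,
      cornerMatrix, finProdFinEquiv, hc, he, hg]
  · exact (H.1.im_star_dotProduct_mulVec_self x).symm

/-- The nonnegative form vanishes at e₀ ⊗ e₀, so its first-order terms vanish when either factor is
varied alone. This removes two entries of the first row and leaves a `cornerMatrix`. -/
theorem IsBlockPositive.isDecomposable_of_apply_zero
    {W : Matrix (Fin 2 × Fin 2) (Fin 2 × Fin 2) ℂ} (H : IsBlockPositive W)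
    (h0 : W (0, 0) (0, 0) = 0) : IsDecomposable W := by
  have hd : ∀ i, W i i = ((W i i).re : ℂ) := fun i =>
    (Complex.conj_eq_iff_re.mp (H.1.apply i i)).symm
  have ha : ∀ i j, W j i = star (W i j) := fun i j => (H.1.apply j i).symm
  have h1 : W (0, 0) (0, 1) = 0 := eq_zero_of_forall_re_nonneg (y := (W (0, 1) (0, 1)).re)
    fun t => by
      have := H.2 ![1, 0] ![1, t]
      simp [dotProduct, Matrix.mulVec, Fintype.sum_prod_type, Fin.sum_univ_two, prodVec, h0,
        ha (0, 0) (0, 1)] at this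
      rw [hd (0, 1)] at this
      simp [← Complex.normSq_eq_norm_sq, Complex.normSq_apply, Complex.mul_re] at this ⊢
      linarith
  have h2 : W (0, 0) (1, 0) = 0 := eq_zero_of_forall_re_nonneg (y := (W (1, 0) (1, 0)).re)
    fun t => by
      have := H.2 ![1, t] ![1, 0]
      simp [dotProduct, Matrix.mulVec, Fintype.sum_prod_type, Fin.sum_univ_two, prodVec, h0,
        ha (0, 0) (1, 0)] at this
      rw [hd (1, 0)] at this
      simp [← Complex.normSq_eq_norm_sq, Complex.normSq_apply, Complex.mul_re] at this ⊢
      linarith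
  have hW : W = cornerMatrix (W (0, 1) (0, 1)).re (W (1, 0) (1, 0)).re (W (1, 1) (1, 1)).re
      (W (0, 0) (1, 1)) (W (0, 1) (1, 0)) (W (1, 0) (1, 1)) (W (0, 1) (1, 1)) := by
    ext ⟨i, j⟩ ⟨k, l⟩
    fin_cases i <;> fin_cases j <;> fin_cases k <;> fin_cases l <;>
      simp [cornerMatrix, finProdFinEquiv, h0, h1, h2, ← hd, ha (0, 0) (0, 1), ha (0, 0) (1, 0),
        ha (0, 0) (1, 1), ha (0, 1) (1, 0), ha (1, 0) (1, 1), ha (0, 1) (1, 1)]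
  have hq : 0 ≤ (W (1, 0) (1, 0)).re := by
    have := H.2 ![0, 1] ![1, 0]
    simpa [dotProduct, Matrix.mulVec, Fintype.sum_prod_type, Fin.sum_univ_two, prodVec] using this
  rw [hW] at H ⊢
  rcases hq.eq_or_lt with hq | hq
  · rw [← hq] at H ⊢
    exact H.cornerMatrix_zero_isDecomposable
  · exact H.cornerMatrix_isDecomposable hq

/-! ### Reduction of block positive matrices to a vanishing corner. -/

theorem isBlockPositive_of_mem_dualCone_SEP {m n : Type*} [Fintype m] [Fintype n]
    {W : Matrix (m × n) (m × n) ℂ} (hW : W ∈ dualCone (SEP m n)) : IsBlockPositive W := by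
  refine ⟨hW.1, fun a b => ?_⟩
  have := (mem_dualCone_SEP_iff.mp hW).2 (Matrix.vecMulVec a (star a)) (Matrix.vecMulVec b (star b))
    (Matrix.posSemidef_vecMulVec_self_star a) (Matrix.posSemidef_vecMulVec_self_star b)
  have h2 : Matrix.vecMulVec a (star a) ⊗ₖ Matrix.vecMulVec b (star b) =
      Matrix.vecMulVec (prodVec a b) (star (prodVec a b)) := by
    ext ⟨i, j⟩ ⟨k, l⟩
    simp [Matrix.vecMulVec_apply, prodVec]
    ring
  rw [h2, Matrix.mul_vecMulVec, Matrix.trace_vecMulVec, dotProduct_comm] at this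
  exact this

theorem IsBlockPositive.conj {m n : Type*} [Fintype m] [Fintype n]
    {W : Matrix (m × n) (m × n) ℂ} (hW : IsBlockPositive W) (A : Matrix m m ℂ) (B : Matrix n n ℂ) :
    IsBlockPositive ((A ⊗ₖ B) * W * (A ⊗ₖ B)ᴴ) := by
  refine ⟨Matrix.isHermitian_mul_mul_conjTranspose _ hW.1, fun a b => ?_⟩
  have h1 : (A ⊗ₖ B)ᴴ *ᵥ prodVec a b = prodVec (Aᴴ *ᵥ a) (Bᴴ *ᵥ b) := by
    ext ⟨i, j⟩
    simp only [prodVec, Matrix.mulVec, dotProduct, Fintype.sum_prod_type, Finset.sum_mul_sum,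
      Matrix.conjTranspose_apply, Matrix.kroneckerMap_apply, star_mul']
    exact Finset.sum_congr rfl fun _ _ => Finset.sum_congr rfl fun _ _ => by ring
  have := hW.2 (Aᴴ *ᵥ a) (Bᴴ *ᵥ b)
  rwa [← h1, Matrix.star_mulVec, Matrix.conjTranspose_conjTranspose, ← Matrix.dotProduct_mulVec,
    Matrix.mulVec_mulVec, Matrix.mulVec_mulVec] at this

theorem IsDecomposable.conj {m n : Type*} [Fintype m] [Fintype n]
    {W : Matrix (m × n) (m × n) ℂ} (hW : IsDecomposable W) (A : Matrix m m ℂ) (B : Matrix n n ℂ) :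
    IsDecomposable ((A ⊗ₖ B) * W * (A ⊗ₖ B)ᴴ) := by
  obtain ⟨P, Q, hP, hQ, rfl⟩ := hW
  refine ⟨_, _, hP.mul_mul_conjTranspose_same (A ⊗ₖ B),
    hQ.mul_mul_conjTranspose_same (A ⊗ₖ B.map star), ?_⟩
  rw [partialTranspose_conj, mul_add, add_mul]
  congr 4 <;> ext <;> simp

/-- The unitary matrix with first row `star a`, for a unit vector `a`. -/
def unitaryOfVec (a : Fin 2 → ℂ) : Matrix (Fin 2) (Fin 2) ℂ := !![star (a 0), star (a 1); -a 1, a 0]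

theorem unitaryOfVec_conjTranspose_mul_self {a : Fin 2 → ℂ} (ha : ‖a 0‖ ^ 2 + ‖a 1‖ ^ 2 = 1) :
    (unitaryOfVec a)ᴴ * unitaryOfVec a = 1 := by
  have h : star (a 0) * a 0 + star (a 1) * a 1 = 1 := by
    rw [Complex.star_def, Complex.conj_mul', Complex.conj_mul']
    exact_mod_cast ha
  ext i j
  fin_cases i <;> fin_cases j <;>
    simp [unitaryOfVec, Matrix.mul_apply, Fin.sum_univ_two] at h ⊢ <;>
    first | ring1 | linear_combination h

/-- This local rotation moves a minimizing product vector to e₀ ⊗ e₀. -/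
theorem form_eq_conj_apply {W : Matrix (Fin 2 × Fin 2) (Fin 2 × Fin 2) ℂ} (a b : Fin 2 → ℂ) :
    ((unitaryOfVec a ⊗ₖ unitaryOfVec b) * W * (unitaryOfVec a ⊗ₖ unitaryOfVec b)ᴴ) (0, 0) (0, 0) =
      star (prodVec a b) ⬝ᵥ W *ᵥ prodVec a b := by
  simp [dotProduct, Matrix.mulVec, Fintype.sum_prod_type, Fin.sum_univ_two, prodVec, unitaryOfVec,
    Matrix.mul_apply]
  ring

theorem IsDecomposable.add_posSemidef {m n : Type*} [Fintype m] [Fintype n]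
    {W R : Matrix (m × n) (m × n) ℂ} (hW : IsDecomposable W) (hR : R.PosSemidef) :
    IsDecomposable (W + R) := by
  obtain ⟨P, Q, hP, hQ, rfl⟩ := hW
  exact ⟨P + R, Q, hP.add hR, hQ, by abel⟩

section ProductForm

variable {m n : Type*}

theorem prodVec_smul_smul (s t : ℂ) (a : m → ℂ) (b : n → ℂ) :
    prodVec (s • a) (t • b) = (s * t) • prodVec a b := by
  ext p
  simp only [prodVec, Pi.smul_apply, smul_eq_mul]
  ring

variable [Fintype m] [Fintype n]

theorem re_form_smul (W : Matrix n n ℂ) (s : ℂ) (x : n → ℂ) :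
    (star (s • x) ⬝ᵥ W *ᵥ (s • x)).re = ‖s‖ ^ 2 * (star x ⬝ᵥ W *ᵥ x).re := by
  rw [star_smul, Matrix.mulVec_smul, smul_dotProduct, dotProduct_smul, smul_smul, smul_eq_mul,
    Complex.star_def, Complex.conj_mul', ← Complex.ofReal_pow, Complex.re_ofReal_mul]

theorem star_prodVec_dotProduct_self (a : EuclideanSpace ℂ m) (b : EuclideanSpace ℂ n) :
    star (prodVec a b) ⬝ᵥ prodVec a b = ((‖a‖ ^ 2 * ‖b‖ ^ 2 : ℝ) : ℂ) := by
  rw [EuclideanSpace.norm_sq_eq, EuclideanSpace.norm_sq_eq, Finset.sum_mul_sum]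
  push_cast
  simp only [dotProduct, Fintype.sum_prod_type, prodVec, Pi.star_apply, star_mul']
  refine Finset.sum_congr rfl fun i _ => Finset.sum_congr rfl fun j _ => ?_
  rw [← Complex.conj_mul', ← Complex.conj_mul', Complex.star_def]
  ring

theorem continuous_re_prodForm (W : Matrix (m × n) (m × n) ℂ) :
    Continuous fun x : EuclideanSpace ℂ m × EuclideanSpace ℂ n =>
      (star (prodVec x.1 x.2) ⬝ᵥ W *ᵥ prodVec x.1 x.2).re := by
  unfold prodVec dotProduct Matrix.mulVec dotProduct
  simp only [Pi.star_apply]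
  fun_prop

/-- The quadratic form attains its minimum over the products of unit vectors. -/
theorem exists_min_prodForm [Nonempty m] [Nonempty n] (W : Matrix (m × n) (m × n) ℂ) :
    ∃ (a : EuclideanSpace ℂ m) (b : EuclideanSpace ℂ n), ‖a‖ = 1 ∧ ‖b‖ = 1 ∧
      ∀ (x : EuclideanSpace ℂ m) (y : EuclideanSpace ℂ n),
        (star (prodVec a b) ⬝ᵥ W *ᵥ prodVec a b).re * (‖x‖ ^ 2 * ‖y‖ ^ 2) ≤
          (star (prodVec x y) ⬝ᵥ W *ᵥ prodVec x y).re := by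
  have hS : IsCompact (Metric.sphere (0 : EuclideanSpace ℂ m) 1 ×ˢ
      Metric.sphere (0 : EuclideanSpace ℂ n) 1) := (isCompact_sphere _ _).prod (isCompact_sphere _ _)
  have hne : (Metric.sphere (0 : EuclideanSpace ℂ m) 1 ×ˢ
      Metric.sphere (0 : EuclideanSpace ℂ n) 1).Nonempty :=
    (NormedSpace.sphere_nonempty.mpr zero_le_one).prod (NormedSpace.sphere_nonempty.mpr zero_le_one)
  obtain ⟨⟨a, b⟩, hab, hmin⟩ := hS.exists_isMinOn hne (continuous_re_prodForm W).continuousOn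
  simp only [Set.mem_prod, mem_sphere_zero_iff_norm] at hab
  refine ⟨a, b, hab.1, hab.2, fun x y => ?_⟩
  rcases eq_or_ne x 0 with rfl | hx
  · simp [prodVec, dotProduct]
  rcases eq_or_ne y 0 with rfl | hy
  · simp [prodVec, dotProduct]
  have hx' : ‖x‖ ≠ 0 := norm_ne_zero_iff.mpr hx
  have hy' : ‖y‖ ≠ 0 := norm_ne_zero_iff.mpr hy
  have hxy : ((‖x‖⁻¹ : ℂ) • x, (‖y‖⁻¹ : ℂ) • y) ∈ Metric.sphere (0 : EuclideanSpace ℂ m) 1 ×ˢ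
      Metric.sphere (0 : EuclideanSpace ℂ n) 1 := by
    simp [norm_smul, hx', hy']
  have h := hmin hxy
  simp only [Set.mem_ofPred_eq, WithLp.ofLp_smul, prodVec_smul_smul] at h
  rw [re_form_smul, norm_mul, norm_inv, norm_inv, Complex.norm_real, Complex.norm_real, norm_norm,
    norm_norm, ← mul_inv, inv_pow, ← div_eq_inv_mul, le_div_iff₀ (by positivity), mul_pow] at h
  exact h

end ProductForm

/-- Every block positive matrix on `ℂ² ⊗ ℂ²` is decomposable. -/
theorem IsBlockPositive.isDecomposable {W : Matrix (Fin 2 × Fin 2) (Fin 2 × Fin 2) ℂ}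
    (H : IsBlockPositive W) : IsDecomposable W := by
  obtain ⟨a, b, ha, hb, hmin⟩ := exists_min_prodForm W
  set μ := (star (prodVec a b) ⬝ᵥ W *ᵥ prodVec a b).re with hμ
  have hμ0 : 0 ≤ μ := H.2 _ _
  have hform : ∀ (x y : EuclideanSpace ℂ (Fin 2)),
      (star (prodVec x y) ⬝ᵥ (W - μ • 1) *ᵥ prodVec x y).re =
        (star (prodVec x y) ⬝ᵥ W *ᵥ prodVec x y).re - μ * (‖x‖ ^ 2 * ‖y‖ ^ 2) := fun x y => by
    rw [Matrix.sub_mulVec, Matrix.smul_mulVec, Matrix.one_mulVec, dotProduct_sub, dotProduct_smul,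
      star_prodVec_dotProduct_self, Complex.sub_re, Complex.smul_re, Complex.ofReal_re, smul_eq_mul]
  -- Subtracting the minimum over unit product vectors keeps block positivity and creates a product
  -- zero; the positive multiple μ of the identity is restored at the end.
  have hsub : IsBlockPositive (W - μ • 1) := by
    refine ⟨H.1.sub ?_, fun x y => ?_⟩
    · rw [Matrix.IsHermitian, Matrix.conjTranspose_smul, Matrix.conjTranspose_one, star_trivial]
    · rw [hform (WithLp.toLp 2 x) (WithLp.toLp 2 y)]
      exact sub_nonneg.mpr (hmin _ _)
  have hunit : ∀ x : EuclideanSpace ℂ (Fin 2), ‖x‖ = 1 →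
      (unitaryOfVec x)ᴴ * unitaryOfVec x = 1 := fun x hx => by
    refine unitaryOfVec_conjTranspose_mul_self ?_
    have := EuclideanSpace.norm_sq_eq x
    rwa [hx, one_pow, Fin.sum_univ_two, eq_comm] at this
  set K := unitaryOfVec a ⊗ₖ unitaryOfVec b with hK
  have hKK : Kᴴ * K = 1 := by
    rw [hK, Matrix.conjTranspose_kronecker, ← Matrix.mul_kronecker_mul, hunit a ha, hunit b hb,
      Matrix.one_kronecker_one]
  have hconj := hsub.conj (unitaryOfVec a) (unitaryOfVec b)
  have hzero : (K * (W - μ • 1) * Kᴴ) (0, 0) (0, 0) = 0 := by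
    rw [← Complex.conj_eq_iff_re.mp (hconj.1.apply (0, 0) (0, 0)), form_eq_conj_apply,
      hform a b, ha, hb, ← hμ]
    simp
  have hdec := (hconj.isDecomposable_of_apply_zero hzero).conj (unitaryOfVec a)ᴴ (unitaryOfVec b)ᴴ
  rw [← Matrix.conjTranspose_kronecker, ← hK, Matrix.conjTranspose_conjTranspose] at hdec
  have hback : Kᴴ * (K * (W - μ • 1) * Kᴴ) * K = W - μ • 1 := by
    rw [Matrix.mul_assoc K, ← Matrix.mul_assoc Kᴴ, hKK, Matrix.one_mul, Matrix.mul_assoc, hKK,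
      Matrix.mul_one]
  rw [hback] at hdec
  have := hdec.add_posSemidef (Matrix.PosSemidef.one.smul hμ0)
  rwa [sub_add_cancel] at this

/-! ### Pure states beyond quantum theory. -/

/-- A pure state of `SEP*` on two qubits that is not positive semidefinite is proportional to the
partial transpose of a rank one projection. -/
theorem IsPureState.exists_eq_partialTranspose {ρ : Matrix (Fin 2 × Fin 2) (Fin 2 × Fin 2) ℂ}
    (hρ : IsPureState (dualCone (SEP (Fin 2) (Fin 2))) ρ) (hpsd : ¬ ρ.PosSemidef) :
    ∃ (c : ℝ) (ψ : Fin 2 × Fin 2 → ℂ), 0 ≤ c ∧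
      ρ = c • partialTranspose (Matrix.vecMulVec ψ (star ψ)) := by
  obtain ⟨P, Q, hP, hQ, h⟩ := (isBlockPositive_of_mem_dualCone_SEP hρ.1.1).isDecomposable
  have htP := trace_re_nonneg_of_mem_dualCone_SEP hP.mem_dualCone_SEP
  have hP0 : P = 0 := by
    rcases htP.eq_or_lt with h0 | h0
    · rw [← hP.trace_eq_zero_iff, ← ofReal_trace_re hP.1, ← h0, Complex.ofReal_zero]
    · refine absurd ?_ hpsd
      rw [hρ.eq_smul_of_eq_add hP.mem_dualCone_SEP hQ.partialTranspose_mem_dualCone_SEP h h0]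
      exact hP.smul (by positivity)
  rw [hP0, zero_add] at h
  obtain ⟨B, hB⟩ := hQ.exists_eq_conjTranspose_mul_self
  -- The rows of B split Q = BᴴB into rank one terms; extremality keeps any one of positive trace.
  let R : Fin 2 × Fin 2 → Matrix (Fin 2 × Fin 2) (Fin 2 × Fin 2) ℂ := fun i =>
    Matrix.vecMulVec (star (B i)) (star (star (B i)))
  have hR : ∀ i, (R i).PosSemidef := fun i => Matrix.posSemidef_vecMulVec_self_star _
  have hsum : Q = ∑ i, R i := by
    rw [hB]
    ext j k
    simp [R, Matrix.mul_apply, Matrix.sum_apply, Matrix.vecMulVec_apply]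
  obtain ⟨i, hi⟩ : ∃ i, 0 < (R i).trace.re := by
    by_contra! hle
    have h1 : ρ.trace.re = ∑ i, (R i).trace.re := by
      rw [h, trace_partialTranspose, hsum, Matrix.trace_sum, Complex.re_sum]
    have h2 := Finset.sum_nonpos fun i (_ : i ∈ Finset.univ) => hle i
    rw [← h1, hρ.1.2, Complex.one_re] at h2
    linarith
  have hrest : (∑ j ∈ Finset.univ.erase i, R j).PosSemidef :=
    Matrix.posSemidef_sum _ fun j _ => hR j
  refine ⟨(R i).trace.re⁻¹, star (B i), by positivity, ?_⟩
  refine hρ.eq_smul_of_eq_add (hR i).partialTranspose_mem_dualCone_SEP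
    hrest.partialTranspose_mem_dualCone_SEP ?_ hi
  rw [h, hsum, ← Finset.add_sum_erase _ _ (Finset.mem_univ i)]
  rfl

/-- The partial transpose of a product vector projection is positive semidefinite. -/
theorem posSemidef_partialTranspose_of_det_eq_zero {ψ : Fin 2 × Fin 2 → ℂ}
    (h : ψ (0, 0) * ψ (1, 1) - ψ (0, 1) * ψ (1, 0) = 0) :
    (partialTranspose (Matrix.vecMulVec ψ (star ψ))).PosSemidef := by
  have hprod : ∃ x y : Fin 2 → ℂ, ψ = prodVec x y := by
    by_cases h0 : ψ (0, 0) = 0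
    · have h1 : ψ (0, 1) = 0 ∨ ψ (1, 0) = 0 := by simpa [h0] using h
      rcases h1 with h1 | h1
      · refine ⟨![0, 1], ![ψ (1, 0), ψ (1, 1)], ?_⟩
        ext ⟨i, j⟩
        fin_cases i <;> fin_cases j <;> simp [prodVec, h0, h1]
      · refine ⟨![ψ (0, 1), ψ (1, 1)], ![0, 1], ?_⟩
        ext ⟨i, j⟩
        fin_cases i <;> fin_cases j <;> simp [prodVec, h0, h1]
    · refine ⟨![1, ψ (1, 0) / ψ (0, 0)], ![ψ (0, 0), ψ (0, 1)], ?_⟩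
      ext ⟨i, j⟩
      fin_cases i <;> fin_cases j <;> simp [prodVec] <;> field_simp
      linear_combination h
  obtain ⟨x, y, rfl⟩ := hprod
  convert Matrix.posSemidef_vecMulVec_self_star (prodVec x (star y)) using 1
  ext ⟨i, j⟩ ⟨k, l⟩
  simp [Matrix.vecMulVec_apply, prodVec]
  ring

/-! ### The Pauli sum and the trace norm. -/

/-- A unitary matrix realizing the trace norm of a `2 × 2` matrix. -/
theorem exists_unitary_norm_trace_sq {M : Matrix (Fin 2) (Fin 2) ℂ} (hM : M.det ≠ 0) :
    ∃ U ∈ Matrix.unitaryGroup (Fin 2) ℂ,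
      ‖(U * M).trace‖ ^ 2 = ∑ i, ∑ j, ‖M i j‖ ^ 2 + 2 * ‖M.det‖ := by
  obtain ⟨u, hu, hdet⟩ := exists_phase M.det
  have huu := mul_star_of_norm_eq_one hu
  set δ := ‖M.det‖ with hδ
  set N := ∑ i, ∑ j, ‖M i j‖ ^ 2 + 2 * δ with hN
  have hN0 : 0 < N := by
    have : 0 < δ := norm_pos_iff.mpr hM
    positivity
  have hNc : (N : ℂ) = M 0 0 * star (M 0 0) + M 0 1 * star (M 0 1) + M 1 0 * star (M 1 0) +
      M 1 1 * star (M 1 1) + 2 * δ := by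
    simp only [hN, Fin.sum_univ_two, Complex.star_def, Complex.mul_conj']
    push_cast
    ring
  have hroot : ((√N : ℝ) : ℂ) * (√N : ℝ) = N := by
    rw [← Complex.ofReal_mul, Real.mul_self_sqrt hN0.le]
  have hroot0 : ((√N : ℝ) : ℂ) ≠ 0 := by
    exact_mod_cast (Real.sqrt_pos.mpr hN0).ne'
  rw [Matrix.det_fin_two] at hdet
  have hdet' := congrArg star hdet
  -- V is the adjoint of M + u adj(M)ᴴ. Both singular values of that matrix equal the trace norm √N
  -- of M, so V/√N is unitary.
  let V : Matrix (Fin 2) (Fin 2) ℂ :=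
    !![star (M 0 0 + u * star (M 1 1)), star (M 1 0 - u * star (M 0 1));
      -(star u * (M 1 0 - u * star (M 0 1))), star u * (M 0 0 + u * star (M 1 1))]
  have hV : V * Vᴴ = (N : ℂ) • 1 := by
    ext i j
    fin_cases i <;> fin_cases j <;>
      simp [V, Matrix.mul_apply, Fin.sum_univ_two] at hNc hdet hdet' huu ⊢
    · linear_combination -hNc + (M 1 1 * starRingEnd ℂ (M 1 1) + M 0 1 * starRingEnd ℂ (M 0 1) +
        2 * δ) * huu + starRingEnd ℂ u * hdet + u * hdet'
    · ring
    · ring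
    · linear_combination u * starRingEnd ℂ u * (-hNc + (M 1 1 * starRingEnd ℂ (M 1 1) +
        M 0 1 * starRingEnd ℂ (M 0 1) + 2 * δ) * huu + starRingEnd ℂ u * hdet + u * hdet') +
        N * huu
  have htr : (V * M).trace = N := by
    simp [V, Matrix.trace_fin_two, Matrix.vecMul, dotProduct, Fin.sum_univ_two] at hNc hdet huu ⊢
    linear_combination -hNc + (M 1 1 * starRingEnd ℂ (M 1 1) + M 0 1 * starRingEnd ℂ (M 0 1) +
      2 * δ) * huu + 2 * starRingEnd ℂ u * hdet
  refine ⟨((√N : ℝ) : ℂ)⁻¹ • V, ?_, ?_⟩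
  · rw [Matrix.mem_unitaryGroup_iff, Matrix.star_eq_conjTranspose, Matrix.conjTranspose_smul,
      smul_mul_smul_comm, hV, smul_smul, star_inv₀, Complex.star_def, Complex.conj_ofReal,
      ← hroot, ← mul_inv, inv_mul_cancel₀ (mul_ne_zero hroot0 hroot0), one_smul]
  · rw [smul_mul_assoc, Matrix.trace_smul, htr, smul_eq_mul, ← hroot, inv_mul_cancel_left₀ hroot0,
      Complex.norm_real, Real.norm_eq_abs, sq_abs, Real.sq_sqrt hN0.le]

/-- `∑ σ_c ⊗ σ_c` is twice the swap operator minus the identity. -/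
theorem sum_trace_mul_pauli (X : Matrix (Fin 2 × Fin 2) (Fin 2 × Fin 2) ℂ) :
    ∑ c, (X * (pauli c ⊗ₖ pauli c)).trace =
      2 * (X (0, 0) (0, 0) + X (0, 1) (1, 0) + X (1, 0) (0, 1) + X (1, 1) (1, 1)) - X.trace := by
  simp [Fin.sum_univ_three, Matrix.trace, Matrix.mul_apply, Fintype.sum_prod_type, Fin.sum_univ_two,
    pauli]
  ring_nf

theorem trace_conj_unitary (ρ : Matrix (Fin 2 × Fin 2) (Fin 2 × Fin 2) ℂ)
    {U V : Matrix (Fin 2) (Fin 2) ℂ} (hU : U ∈ Matrix.unitaryGroup (Fin 2) ℂ)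
    (hV : V ∈ Matrix.unitaryGroup (Fin 2) ℂ) :
    ((U ⊗ₖ V) * ρ * (Uᴴ ⊗ₖ Vᴴ)).trace = ρ.trace := by
  rw [Matrix.trace_mul_comm, ← Matrix.mul_assoc, ← Matrix.mul_kronecker_mul]
  rw [Matrix.mem_unitaryGroup_iff', Matrix.star_eq_conjTranspose] at hU hV
  rw [hU, hV, Matrix.one_kronecker_one, Matrix.one_mul]

theorem APauli_le_one {ρ : Matrix (Fin 2 × Fin 2) (Fin 2 × Fin 2) ℂ} (hρ : ρ.PosSemidef)
    (htr : ρ.trace = 1) {U V : Matrix (Fin 2) (Fin 2) ℂ} (hU : U ∈ Matrix.unitaryGroup (Fin 2) ℂ)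
    (hV : V ∈ Matrix.unitaryGroup (Fin 2) ℂ) : APauli ρ U V ≤ 1 := by
  rw [APauli, sum_trace_mul_pauli]
  have htr' := trace_conj_unitary ρ hU hV
  have hX := hρ.mul_mul_conjTranspose_same (U ⊗ₖ V)
  rw [Matrix.conjTranspose_kronecker] at hX
  set X := (U ⊗ₖ V) * ρ * (Uᴴ ⊗ₖ Vᴴ)
  -- Positivity is tested on the singlet, the antisymmetric vector spanning the range of 1 - S.
  have h := (Complex.nonneg_iff.mp (hX.dotProduct_mulVec_nonneg
    fun p => ![![0, 1], ![-1, 0]] p.1 p.2)).1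
  have ht : X.trace.re = 1 := by rw [htr', htr, Complex.one_re]
  simp [dotProduct, Matrix.mulVec, Matrix.trace, Fintype.sum_prod_type, Fin.sum_univ_two] at h ht ⊢
  linarith

theorem exists_one_lt_APauli {c : ℝ} (hc : 0 ≤ c) {ψ : Fin 2 × Fin 2 → ℂ}
    (htr : (c • partialTranspose (Matrix.vecMulVec ψ (star ψ))).trace = 1)
    (hdet : ψ (0, 0) * ψ (1, 1) - ψ (0, 1) * ψ (1, 0) ≠ 0) :
    ∃ U ∈ Matrix.unitaryGroup (Fin 2) ℂ, ∃ V ∈ Matrix.unitaryGroup (Fin 2) ℂ,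
      1 < APauli (c • partialTranspose (Matrix.vecMulVec ψ (star ψ))) U V := by
  let M : Matrix (Fin 2) (Fin 2) ℂ := Matrix.of fun i j => ψ (i, j)
  have hM : M.det ≠ 0 := by simpa [Matrix.det_fin_two, M] using hdet
  obtain ⟨U, hU, hUM⟩ := exists_unitary_norm_trace_sq hM
  refine ⟨U, hU, 1, one_mem _, ?_⟩
  have htr' : c * ∑ i, ∑ j, ‖M i j‖ ^ 2 = 1 := by
    have h := congrArg Complex.re htr
    simpa [Matrix.trace_smul, trace_partialTranspose, Matrix.trace_vecMulVec, dotProduct,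
      Fintype.sum_prod_type, M, Complex.mul_conj', ← Complex.ofReal_pow,
      mul_add] using h
  have hc0 : 0 < c := hc.lt_of_ne (by rintro rfl; simp at htr')
  rw [APauli, sum_trace_mul_pauli, trace_conj_unitary _ hU (one_mem _), htr,
    ← Matrix.conjTranspose_kronecker]
  -- Pairing the swap with Γ(φφ*) gives |φ₀₀ + φ₁₁|², and the coefficient matrix of φ = (U ⊗ 1)ψ is
  -- UM.
  have hswap : ∀ X : Matrix (Fin 2 × Fin 2) (Fin 2 × Fin 2) ℂ,
      X = c • partialTranspose ((U ⊗ₖ 1) * Matrix.vecMulVec ψ (star ψ) * (U ⊗ₖ 1)ᴴ) →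
      X (0, 0) (0, 0) + X (0, 1) (1, 0) + X (1, 0) (0, 1) + X (1, 1) (1, 1) =
        ((c * ‖(U * M).trace‖ ^ 2 : ℝ) : ℂ) := by
    rintro X rfl
    rw [Complex.ofReal_mul, Complex.ofReal_pow, ← Complex.mul_conj']
    rw [Matrix.mul_vecMulVec, Matrix.vecMulVec_mul, ← Matrix.star_mulVec]
    simp [Matrix.vecMulVec_apply, Matrix.mulVec, dotProduct, Fintype.sum_prod_type,
      Fin.sum_univ_two, Matrix.trace_fin_two, Matrix.mul_apply, M]
    ring
  rw [hswap]
  · rw [hUM, Complex.sub_re, Complex.one_re, ← Complex.ofReal_ofNat, Complex.re_ofReal_mul,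
      Complex.ofReal_re]
    have : 0 < c * ‖M.det‖ := mul_pos hc0 (norm_pos_iff.mpr hM)
    linarith
  -- Partial transposition conjugates only the second factor, which is the identity here.
  · rw [partialTranspose_conj, Matrix.mul_smul, Matrix.smul_mul]
    congr 4 <;> ext i j <;> simp [Matrix.one_apply, apply_ite]

theorem theorem3 :
    (∀ ρ₀ : Matrix (Fin 2 × Fin 2) (Fin 2 × Fin 2) ℂ,
      IsBeyondQuantum ρ₀ → IsPureState (dualCone (SEP (Fin 2) (Fin 2))) ρ₀ →
        ∃ UA ∈ Matrix.unitaryGroup (Fin 2) ℂ, ∃ UB ∈ Matrix.unitaryGroup (Fin 2) ℂ,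
          1 < APauli ρ₀ UA UB) ∧
    (∀ ρ₁ ∈ stateSpace (SES (Fin 2) (Fin 2)),
      ∀ UA ∈ Matrix.unitaryGroup (Fin 2) ℂ, ∀ UB ∈ Matrix.unitaryGroup (Fin 2) ℂ,
        APauli ρ₁ UA UB ≤ 1) := by
  refine ⟨fun ρ hbq hpure => ?_, fun ρ hρ U hU V hV => APauli_le_one hρ.1 hρ.2 hU hV⟩
  have hpsd : ¬ ρ.PosSemidef := fun h => hbq.2 ⟨h, hbq.1.2⟩
  obtain ⟨c, ψ, hc, rfl⟩ := hpure.exists_eq_partialTranspose hpsd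
  exact exists_one_lt_APauli hc hbq.1.2 fun h =>
    hpsd ((posSemidef_partialTranspose_of_det_eq_zero h).smul hc)
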